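/- Let $N \ge 1$, let $\Omega \subset \mathbb{R}^N$ be a bounded open Lipschitz set, i.e. a bounded open set such that every point $p \in \partial\Omega$ has an open neighbourhood $N_p$ in which, after a suitable orthogonal change of coordinates, $\partial\Omega \cap N_p$ is the graph (within $N_p$) of a Lipschitz function $\mathbb{R}^{N-1} \to \mathbb{R}$. Let $s \in [0,1)$ and let $\langle u,v\rangle_2 = \int_\Omega uv\,dx$ be the scalar product of the real space $L^2(\Omega)$. Put $$\mathbb{H}^s(\Omega) := \Big\{ u \in L^2(\Omega) : \int_\Omega\int_\Omega \frac{(u(x)-u(y))^2}{|x-y|^{N+2s}}\,dx\,dy < \infty \Big\}$$ (so that the kernel is $|x-y|^{-N}$ for $s=0$), and, for $u, v \in \mathbb{H}^s(\Omega)$, $$\mathcal{E}_s(u,v) := \frac12 \int_\Omega\int_\Omega \frac{(u(x)-u(y))(v(x)-v(y))}{|x-y|^{N+2s}}\,dx\,dy.$$ Then: (i) $\mathcal{E}_s(u,v)$ is well defined for all $u,v\in \mathbb{H}^s(\Omega)$ (the integral converges absolutely), and $\mathbb{H}^s(\Omega)$ is a Hilbert space with the inner product $\langle u,v\rangle_{\mathbb{H}^s(\Omega)}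 := \langle u,v\rangle_2 + \mathcal{E}_s(u,v)$; (ii) $\mathbb{H}^s(\Omega)$ is compactly embedded into $L^2(\Omega)$, i.e. the inclusion map $\mathbb{H}^s(\Omega) \to L^2(\Omega)$ is a compact operator. -/

import Mathlib

open MeasureTheory

/-- A Lipschitz set: a bounded open set `Ω ⊆ ℝ^N` such that every `p ∈ ∂Ω` has an open neighbourhood
`U` in which, after a linear isometric change of coordinates `ℝ^N ≅ ℝ^(N-1) × ℝ`, the boundary is
the graph of a Lipschitz function `φ : ℝ^(N-1) → ℝ`. -/
structure IsLipschitzSet {N : ℕ} (Ω : Set (EuclideanSpace ℝ (Fin N))) : Prop where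
  isOpen : IsOpen Ω
  isBounded : Bornology.IsBounded Ω
  boundary_graph : ∀ p ∈ frontier Ω,
    ∃ (U : Set (EuclideanSpace ℝ (Fin N)))
      (T : EuclideanSpace ℝ (Fin N) ≃ₗᵢ[ℝ] WithLp 2 (EuclideanSpace ℝ (Fin (N - 1)) × ℝ))
      (K : NNReal) (φ : EuclideanSpace ℝ (Fin (N - 1)) → ℝ),
      IsOpen U ∧ p ∈ U ∧ LipschitzWith K φ ∧
        ∀ x ∈ U, x ∈ frontier Ω ↔ (T x).snd = φ (T x).fst

/-- The real Lebesgue space `L²(Ω)`. -/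
abbrev L2Space {N : ℕ} (Ω : Set (EuclideanSpace ℝ (Fin N))) : Type :=
  Lp ℝ 2 (volume.restrict Ω)

/-- The integrand `(u(x) - u(y)) (v(x) - v(y)) / |x - y|^(N + 2s)`. -/
noncomputable def formIntegrand {N : ℕ} (s : ℝ) (u v : EuclideanSpace ℝ (Fin N) → ℝ)
    (p : EuclideanSpace ℝ (Fin N) × EuclideanSpace ℝ (Fin N)) : ℝ :=
  (u p.1 - u p.2) * (v p.1 - v p.2) / ‖p.1 - p.2‖ ^ ((N : ℝ) + 2 * s)

/-- The double integral
`∫_Ω ∫_Ω (u(x) - u(y))² / |x - y|^(N + 2s) dx dy`, with values in `[0, ∞]`. -/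
noncomputable def seminormIntegral {N : ℕ} (Ω : Set (EuclideanSpace ℝ (Fin N))) (s : ℝ)
    (u : EuclideanSpace ℝ (Fin N) → ℝ) : ENNReal :=
  ∫⁻ p, ENNReal.ofReal ((u p.1 - u p.2) ^ 2 / ‖p.1 - p.2‖ ^ ((N : ℝ) + 2 * s))
    ∂((volume.restrict Ω).prod (volume.restrict Ω))

theorem seminormIntegral_congr {N : ℕ} {Ω : Set (EuclideanSpace ℝ (Fin N))} {s : ℝ}
    {u v : EuclideanSpace ℝ (Fin N) → ℝ} (h : u =ᵐ[volume.restrict Ω] v) :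
    seminormIntegral Ω s u = seminormIntegral Ω s v := by
  refine lintegral_congr_ae ?_
  have h1 := (Measure.quasiMeasurePreserving_fst (μ := volume.restrict Ω)
    (ν := volume.restrict Ω)).ae_eq_comp h
  have h2 := (Measure.quasiMeasurePreserving_snd (μ := volume.restrict Ω)
    (ν := volume.restrict Ω)).ae_eq_comp h
  filter_upwards [h1, h2] with p hp1 hp2
  simp only [Function.comp] at hp1 hp2
  simp only [hp1, hp2]

theorem seminormIntegral_add_lt_top {N : ℕ} {Ω : Set (EuclideanSpace ℝ (Fin N))} {s : ℝ}
    {u v : EuclideanSpace ℝ (Fin N) → ℝ} (hum : Measurable u)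
    (hu : seminormIntegral Ω s u < ⊤) (hv : seminormIntegral Ω s v < ⊤) :
    seminormIntegral Ω s (u + v) < ⊤ := by
  have key : seminormIntegral Ω s (u + v)
      ≤ ENNReal.ofReal 2 * seminormIntegral Ω s u
        + ENNReal.ofReal 2 * seminormIntegral Ω s v := by
    unfold seminormIntegral
    rw [← lintegral_const_mul' _ _ (by simp), ← lintegral_const_mul' _ _ (by simp),
      ← lintegral_add_left (by fun_prop)]
    refine lintegral_mono fun p => ?_
    rw [← ENNReal.ofReal_mul (by norm_num), ← ENNReal.ofReal_mul (by norm_num),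
      ← ENNReal.ofReal_add (by positivity) (by positivity)]
    refine ENNReal.ofReal_le_ofReal ?_
    rw [← mul_div_assoc, ← mul_div_assoc, ← add_div]
    refine div_le_div_of_nonneg_right ?_ (by positivity)
    simp only [Pi.add_apply]
    nlinarith [sq_nonneg ((u p.1 - u p.2) - (v p.1 - v p.2))]
  exact key.trans_lt (ENNReal.add_lt_top.2
    ⟨ENNReal.mul_lt_top (by simp) hu, ENNReal.mul_lt_top (by simp) hv⟩)

theorem seminormIntegral_smul {N : ℕ} {Ω : Set (EuclideanSpace ℝ (Fin N))} {s : ℝ}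
    (c : ℝ) (u : EuclideanSpace ℝ (Fin N) → ℝ) :
    seminormIntegral Ω s (c • u) = ENNReal.ofReal (c ^ 2) * seminormIntegral Ω s u := by
  unfold seminormIntegral
  rw [← lintegral_const_mul' _ _ (by simp)]
  refine lintegral_congr fun p => ?_
  rw [← ENNReal.ofReal_mul (by positivity)]
  congr 1
  simp only [Pi.smul_apply, smul_eq_mul]
  ring

/-- The elements `u` of `L²(Ω)` with
`∫_Ω ∫_Ω (u(x) - u(y))² / |x - y|^(N + 2s) dx dy < ∞`, as a linear subspace of `L²(Ω)`.
For `s = 0` the kernel is `|x - y|^(-N)`. -/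
noncomputable def HsSubmodule {N : ℕ} (Ω : Set (EuclideanSpace ℝ (Fin N))) (s : ℝ) :
    Submodule ℝ (L2Space Ω) where
  carrier := {u | seminormIntegral Ω s u < ⊤}
  zero_mem' := by
    have h : seminormIntegral Ω s ((0 : L2Space Ω) : EuclideanSpace ℝ (Fin N) → ℝ) = 0 := by
      rw [seminormIntegral_congr (Lp.coeFn_zero ℝ 2 (volume.restrict Ω))]
      simp [seminormIntegral]
    change seminormIntegral Ω s _ < ⊤
    rw [h]
    exact ENNReal.zero_lt_top
  add_mem' := by
    intro u v hu hv
    change seminormIntegral Ω s _ < ⊤ at hu hv ⊢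
    rw [seminormIntegral_congr (Lp.coeFn_add u v)]
    exact seminormIntegral_add_lt_top (Lp.stronglyMeasurable u).measurable hu hv
  smul_mem' := by
    intro c u hu
    change seminormIntegral Ω s _ < ⊤ at hu ⊢
    rw [seminormIntegral_congr (Lp.coeFn_smul c u), seminormIntegral_smul]
    exact ENNReal.mul_lt_top ENNReal.ofReal_lt_top hu

/-- The vector space `ℍ^s(Ω)`. It is a type of its own, so that it does not inherit the norm and the
topology of `L²(Ω)`. -/
def HsSpace {N : ℕ} (Ω : Set (EuclideanSpace ℝ (Fin N))) (s : ℝ) : Type :=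
  ↥(HsSubmodule Ω s)

noncomputable instance {N : ℕ} (Ω : Set (EuclideanSpace ℝ (Fin N))) (s : ℝ) :
    AddCommGroup (HsSpace Ω s) :=
  inferInstanceAs (AddCommGroup ↥(HsSubmodule Ω s))

noncomputable instance {N : ℕ} (Ω : Set (EuclideanSpace ℝ (Fin N))) (s : ℝ) :
    Module ℝ (HsSpace Ω s) :=
  inferInstanceAs (Module ℝ ↥(HsSubmodule Ω s))

/-- The inclusion `ℍ^s(Ω) → L²(Ω)`. -/
noncomputable def HsSpace.toL2 {N : ℕ} {Ω : Set (EuclideanSpace ℝ (Fin N))} {s : ℝ} :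
    HsSpace Ω s →ₗ[ℝ] L2Space Ω :=
  (HsSubmodule Ω s).subtype

/-- The bilinear form
`ℰ_s(u, v) = 1/2 ∫_Ω ∫_Ω (u(x) - u(y)) (v(x) - v(y)) / |x - y|^(N + 2s) dx dy`. -/
noncomputable def formE {N : ℕ} (Ω : Set (EuclideanSpace ℝ (Fin N))) (s : ℝ)
    (u v : EuclideanSpace ℝ (Fin N) → ℝ) : ℝ :=
  (1 / 2) * ∫ p, formIntegrand s u v p ∂((volume.restrict Ω).prod (volume.restrict Ω))

open MeasureTheory

/-! Compactness comes from the kernel `|x - y|^(-a)`, `a = N + 2s ≥ N`, failing to be integrable at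
the vertex of a cone; this includes the logarithmic divergence at `s = 0`. A Lipschitz set has an
interior cone at every point of its compact closure, so for small `η` the potential of the bounded
kernel `regKernel a η` exceeds any given `M` on the whole closure
(`exists_forall_lt_integral_regKernel`).

Expanding the square against this bounded kernel `k` gives `M‖w‖² ≤ ½ ∬ (w x - w y)² k + |∬ w x w y
k|` (`mul_integral_sq_le`). The first term is bounded by the energy. In the second, `k` is
continuous on a compact set, so finitely many functionals `∫ k (x₀, y) w y dy` control it. Taking
`M` large makes `‖w‖` small, and the unit ball of `ℍ^s(Ω)` is totally bounded in `L²(Ω)`.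

For the Hilbert space structure, the form is half the `L²(Ω × Ω)` inner product of difference
quotients. The norm is thus a weighted graph norm of a closed operator, which gives completeness. -/

/-! ### Regularized kernels and their potentials. -/

/-- The bounded approximation `1 / (t ^ a + η)` of the kernel `1 / t ^ a`. -/
noncomputable def regKernel (a η t : ℝ) : ℝ := (t ^ a + η)⁻¹

theorem regKernel_nonneg {a η t : ℝ} (hη : 0 < η) (ht : 0 ≤ t) : 0 ≤ regKernel a η t := by
  unfold regKernel; positivity

theorem regKernel_le {a η t : ℝ} (hη : 0 < η) (ht : 0 ≤ t) : regKernel a η t ≤ η⁻¹ :=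
  inv_anti₀ hη (le_add_of_nonneg_left (by positivity))

theorem regKernel_anti {a η η' t : ℝ} (hη : 0 < η) (h : η ≤ η') (ht : 0 ≤ t) :
    regKernel a η' t ≤ regKernel a η t :=
  inv_anti₀ (by positivity) (by linarith)

theorem continuous_regKernel_norm {E : Type*} [NormedAddCommGroup E] {a η : ℝ} (ha : 0 ≤ a)
    (hη : 0 < η) : Continuous fun p : E × E => regKernel a η ‖p.1 - p.2‖ := by
  unfold regKernel
  refine Continuous.inv₀ ?_ fun p => by positivity
  exact ((by fun_prop : Continuous fun p : E × E => ‖p.1 - p.2‖).rpow_const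
    fun _ => Or.inr ha).add continuous_const

section Potential

variable {E : Type*} [NormedAddCommGroup E] [MeasurableSpace E]
  [BorelSpace E] {a η : ℝ}

theorem integrable_regKernel (μ : Measure E) [IsFiniteMeasure μ] (ha : 0 ≤ a) (hη : 0 < η)
    (x : E) : Integrable (fun y => regKernel a η ‖x - y‖) μ := by
  refine Integrable.of_bound (C := η⁻¹) ?_ (ae_of_all _ fun y => ?_)
  · exact ((continuous_regKernel_norm ha hη).comp
      (Continuous.prodMk_right x)).aestronglyMeasurable
  · rw [Real.norm_of_nonneg (regKernel_nonneg hη (norm_nonneg _))]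
    exact regKernel_le hη (norm_nonneg _)

theorem continuous_integral_regKernel (μ : Measure E) [IsFiniteMeasure μ] (ha : 0 ≤ a)
    (hη : 0 < η) : Continuous fun x => ∫ y, regKernel a η ‖x - y‖ ∂μ := by
  refine continuous_of_dominated (bound := fun _ => η⁻¹)
    (fun x => (integrable_regKernel μ ha hη x).aestronglyMeasurable)
    (fun x => ae_of_all _ fun y => ?_) (integrable_const _) (ae_of_all _ fun y => ?_)
  · rw [Real.norm_of_nonneg (regKernel_nonneg hη (norm_nonneg _))]
    exact regKernel_le hη (norm_nonneg _)
  · exact (continuous_regKernel_norm ha hη).comp (Continuous.prodMk_left y)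

end Potential

/-! ### Interior cones and divergence of the potential. -/

/-- `Ω` contains a truncated open cone with vertex `x`. -/
def HasInteriorCone {E : Type*} [NormedAddCommGroup E] [NormedSpace ℝ E] (Ω : Set E) (x : E) :
    Prop :=
  ∃ (z : E) (ρ : ℝ), z ≠ 0 ∧ 0 < ρ ∧ ∀ t ∈ Set.Ioc (0 : ℝ) 1, Metric.ball (x + t • z) (t * ρ) ⊆ Ω

theorem HasInteriorCone.of_mem_isOpen {E : Type*} [NormedAddCommGroup E] [NormedSpace ℝ E]
    [Nontrivial E] {Ω : Set E} (hΩ : IsOpen Ω) {x : E} (hx : x ∈ Ω) : HasInteriorCone Ω x := by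
  obtain ⟨r, hr, hb⟩ := Metric.isOpen_iff.1 hΩ x hx
  obtain ⟨z, hz⟩ := exists_norm_eq E (show 0 ≤ r / 2 by positivity)
  refine ⟨z, r / 2, ?_, by positivity, fun t ht => (Metric.ball_subset_ball' ?_).trans hb⟩
  · rw [← norm_pos_iff, hz]; positivity
  · rw [dist_eq_norm, add_sub_cancel_left, norm_smul, hz, Real.norm_of_nonneg ht.1.le]
    nlinarith [ht.2]

/-- At the vertex of an interior cone the potential of `|x - y| ^ (-a)`, `a ≥ N`, is infinite. -/
theorem HasInteriorCone.exists_lt_integral_regKernel {N : ℕ} {Ω : Set (EuclideanSpace ℝ (Fin N))}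
    (hfin : volume Ω < ⊤) {x : EuclideanSpace ℝ (Fin N)} (hx : HasInteriorCone Ω x)
    {a : ℝ} (ha0 : 0 ≤ a) (ha : (N : ℝ) ≤ a) (M : ℝ) :
    ∃ η > 0, M < ∫ y in Ω, regKernel a η ‖x - y‖ := by
  obtain ⟨z, ρ', hz, hρ', hball'⟩ := hx
  have hz0 : 0 < ‖z‖ := norm_pos_iff.2 hz
  obtain ⟨ρ, hρ, hρz, hball⟩ : ∃ ρ > 0, ρ ≤ ‖z‖ / 4 ∧
      ∀ t ∈ Set.Ioc (0 : ℝ) 1, Metric.ball (x + t • z) (t * ρ) ⊆ Ω := by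
    -- The cap `‖z‖ / 4` keeps the ball at scale `t` at distances between `3/4 t‖z‖` and `5/4 t‖z‖`
    -- from `x`.
    refine ⟨min ρ' (‖z‖ / 4), by positivity, min_le_right _ _, fun t ht => ?_⟩
    refine (Metric.ball_subset_ball ?_).trans (hball' t ht)
    exact mul_le_mul_of_nonneg_left (min_le_left _ _) ht.1.le
  -- Ratio `1/4` makes the shells of `hnorm` disjoint, since `2 * (1/4) < 3/4`.
  let q : ℕ → ℝ := fun j => (1 / 4 : ℝ) ^ j
  have hq0 : ∀ j, 0 < q j := fun j => by positivity
  have hq1 : ∀ j, q j ≤ 1 := fun j => pow_le_one₀ (by norm_num) (by norm_num)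
  let B : ℕ → Set (EuclideanSpace ℝ (Fin N)) := fun j => Metric.ball (x + q j • z) (q j * ρ)
  have hBΩ : ∀ j, B j ⊆ Ω := fun j => hball _ ⟨hq0 j, hq1 j⟩
  have hnorm : ∀ j, ∀ y ∈ B j, q j * (3 / 4 * ‖z‖) < ‖x - y‖ ∧ ‖x - y‖ < q j * (2 * ‖z‖) := by
    intro j y hy
    have h1 : ‖y - (x + q j • z)‖ < q j * ρ := by simpa [B, dist_eq_norm] using hy
    have h2 : ‖q j • z‖ = q j * ‖z‖ := by rw [norm_smul, Real.norm_of_nonneg (hq0 j).le]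
    have h3 : ‖q j • z‖ ≤ ‖x - y‖ + ‖y - (x + q j • z)‖ := by
      rw [← norm_neg (q j • z)]
      refine le_trans (le_of_eq ?_) (norm_add_le _ _)
      congr 1; abel
    have h4 : ‖x - y‖ ≤ ‖q j • z‖ + ‖y - (x + q j • z)‖ := by
      rw [← norm_neg (q j • z), ← norm_neg (y - _)]
      refine le_trans (le_of_eq ?_) (norm_add_le _ _)
      congr 1; abel
    have h5 := mul_le_mul_of_nonneg_left hρz (hq0 j).le
    have h6 : 0 < q j * ‖z‖ := mul_pos (hq0 j) hz0
    constructor <;> nlinarith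
  have hdisj : Pairwise (Function.onFun Disjoint B) := by
    have key : ∀ i j, i < j → Disjoint (B i) (B j) := by
      intro i j hij
      rw [Set.disjoint_left]
      intro y hyi hyj
      have h1 := (hnorm i y hyi).1
      have h2 := (hnorm j y hyj).2
      have h3 : q j ≤ q i * (1 / 4) := by
        have : q j ≤ (1 / 4 : ℝ) ^ (i + 1) :=
          pow_le_pow_of_le_one (by norm_num) (by norm_num) hij
        simpa [q, pow_succ] using this
      nlinarith [mul_le_mul_of_nonneg_right h3 hz0.le, mul_pos (hq0 i) hz0]
    intro i j hij
    rcases lt_or_gt_of_ne hij with h | h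
    · exact key i j h
    · exact (key j i h).symm
  let ω : ℝ := volume.real (Metric.ball (0 : EuclideanSpace ℝ (Fin N)) 1)
  have hω : 0 < ω := ENNReal.toReal_pos (Metric.measure_ball_pos _ _ one_pos).ne'
    measure_ball_lt_top.ne
  -- A lower bound for each ball's share, independent of the scale: volume `∼ q j ^ N` times kernel
  -- `∼ q j ^ (-a)`, and `q j ^ (N - a) ≥ 1`.
  let c : ℝ := ρ ^ N * ω * (2 * (2 * ‖z‖) ^ a)⁻¹
  have hc : 0 < c := by positivity
  obtain ⟨J, hJ⟩ := exists_nat_gt (M / c)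
  -- At the scales `j < J` this `η` at most doubles the bound on the denominator, whence the 2 in
  -- `c`.
  let η : ℝ := (q J * (2 * ‖z‖)) ^ a
  have hη : 0 < η := by have := hq0 J; positivity
  have : IsFiniteMeasure (volume.restrict Ω) := ⟨by simpa using hfin⟩
  have hint := integrable_regKernel (volume.restrict Ω) ha0 hη x
  have hsub : (⋃ j ∈ Finset.range J, B j) ⊆ Ω := by
    simp only [Set.iUnion_subset_iff]; exact fun j _ => hBΩ j
  refine ⟨η, hη, ?_⟩
  have hlow : ∀ j ∈ Finset.range J, c ≤ ∫ y in B j, regKernel a η ‖x - y‖ := by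
    intro j hj
    have hqJ : q J ≤ q j := pow_le_pow_of_le_one (by norm_num) (by norm_num)
      (Finset.mem_range.1 hj).le
    have hqj := hq0 j
    have hk : ∀ y ∈ B j, (2 * (q j * (2 * ‖z‖)) ^ a)⁻¹ ≤ regKernel a η ‖x - y‖ := by
      intro y hy
      refine inv_anti₀ (by positivity) ?_
      have h1 : ‖x - y‖ ^ a ≤ (q j * (2 * ‖z‖)) ^ a :=
        Real.rpow_le_rpow (norm_nonneg _) (hnorm j y hy).2.le ha0
      have h2 : η ≤ (q j * (2 * ‖z‖)) ^ a :=
        Real.rpow_le_rpow (by have := hq0 J; positivity) (by gcongr) ha0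
      linarith
    have hvol : volume.real (B j) = (q j * ρ) ^ N * ω := by
      simp only [B, ω, measureReal_def]
      rw [Measure.addHaar_ball_of_pos _ _ (by positivity), ENNReal.toReal_mul,
        ENNReal.toReal_ofReal (by positivity), finrank_euclideanSpace_fin]
    calc c ≤ (2 * (q j * (2 * ‖z‖)) ^ a)⁻¹ * volume.real (B j) := by
          rw [hvol, Real.mul_rpow hqj.le (by positivity)]
          have h1 : q j ^ a ≤ q j ^ N := by
            rw [← Real.rpow_natCast]
            exact Real.rpow_le_rpow_of_exponent_ge hqj (hq1 j) ha
          have h2 : 0 < q j ^ a := by positivity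
          have h3 : 1 ≤ (q j ^ a)⁻¹ * q j ^ N := by
            rw [inv_mul_eq_div, one_le_div h2]; exact h1
          have : (2 * (q j ^ a * (2 * ‖z‖) ^ a))⁻¹ * ((q j * ρ) ^ N * ω)
              = c * ((q j ^ a)⁻¹ * q j ^ N) := by
            simp only [c, mul_pow, mul_inv]; ring
          rw [this]
          exact le_mul_of_one_le_right hc.le h3
      _ ≤ _ := by
          refine setIntegral_ge_of_const_le_real measurableSet_ball measure_ball_lt_top.ne hk ?_
          exact hint.mono_measure (Measure.restrict_mono (hBΩ j) le_rfl)
  calc M < J * c := by rwa [div_lt_iff₀ hc] at hJ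
    _ = ∑ j ∈ Finset.range J, c := by simp
    _ ≤ ∑ j ∈ Finset.range J, ∫ y in B j, regKernel a η ‖x - y‖ := Finset.sum_le_sum hlow
    _ = ∫ y in ⋃ j ∈ Finset.range J, B j, regKernel a η ‖x - y‖ := by
        rw [integral_biUnion_finset _ (fun j _ => measurableSet_ball)
          (fun i _ j _ hij => hdisj hij)]
        exact fun j _ => hint.mono_measure (Measure.restrict_mono (hBΩ j) le_rfl)
    _ ≤ ∫ y in Ω, regKernel a η ‖x - y‖ :=
        setIntegral_mono_set hint (ae_of_all _ fun y => regKernel_nonneg hη (norm_nonneg _))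
          hsub.eventuallyLE

/-- If every point of a compact set is the vertex of an interior cone, then the potential is
uniformly large on that set. -/
theorem exists_forall_lt_integral_regKernel {N : ℕ} {Ω K : Set (EuclideanSpace ℝ (Fin N))}
    (hfin : volume Ω < ⊤) (hK : IsCompact K) (hcone : ∀ x ∈ K, HasInteriorCone Ω x)
    {a : ℝ} (ha0 : 0 ≤ a) (ha : (N : ℝ) ≤ a) (M : ℝ) :
    ∃ η > 0, ∀ x ∈ K, M < ∫ y in Ω, regKernel a η ‖x - y‖ := by
  have : IsFiniteMeasure (volume.restrict Ω) := ⟨by simpa using hfin⟩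
  have hanti : ∀ η η' x, 0 < η → η ≤ η' →
      ∫ y in Ω, regKernel a η' ‖x - y‖ ≤ ∫ y in Ω, regKernel a η ‖x - y‖ := by
    intro η η' x hη h
    exact integral_mono (integrable_regKernel _ ha0 (hη.trans_le h) x)
      (integrable_regKernel _ ha0 hη x) fun y => regKernel_anti hη h (norm_nonneg _)
  -- Decreasing `η` only raises the potential, so finitely many local choices of `η` merge into
  -- their minimum; locally, continuity of the potential suffices.
  refine hK.induction_on (p := fun s => ∃ η > 0, ∀ x ∈ s, M < ∫ y in Ω, regKernel a η ‖x - y‖)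
    ⟨1, one_pos, by simp⟩ ?_ ?_ ?_
  · rintro s t hst ⟨η, hη, h⟩
    exact ⟨η, hη, fun x hx => h x (hst hx)⟩
  · rintro s t ⟨η, hη, h⟩ ⟨η', hη', h'⟩
    refine ⟨min η η', lt_min hη hη', ?_⟩
    rintro x (hx | hx)
    · exact (h x hx).trans_le (hanti _ _ x (lt_min hη hη') (min_le_left _ _))
    · exact (h' x hx).trans_le (hanti _ _ x (lt_min hη hη') (min_le_right _ _))
  · intro x hx
    obtain ⟨η, hη, h⟩ := (hcone x hx).exists_lt_integral_regKernel hfin ha0 ha M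
    refine ⟨_, mem_nhdsWithin_of_mem_nhds
      ((continuous_integral_regKernel (volume.restrict Ω) ha0 hη).continuousAt.eventually
        (lt_mem_nhds h)), η, hη, fun y hy => hy⟩

/-! ### Lipschitz sets have interior cones. -/

theorem IsPreconnected.subset_or_disjoint_of_disjoint_frontier {X : Type*} [TopologicalSpace X]
    {s t : Set X} (hs : IsPreconnected s) (h : Disjoint s (frontier t)) :
    s ⊆ t ∨ Disjoint s t := by
  have hcov : s ⊆ interior t ∪ (closure t)ᶜ := by
    intro x hx
    by_contra hcon
    simp only [Set.mem_union, Set.mem_compl_iff, not_or, not_not] at hcon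
    exact Set.disjoint_left.1 h hx ⟨hcon.2, hcon.1⟩
  have hdisj : Disjoint (interior t) (closure t)ᶜ :=
    Set.disjoint_compl_right_iff_subset.2 (interior_subset.trans subset_closure)
  rcases hs.subset_or_subset isOpen_interior isClosed_closure.isOpen_compl hdisj hcov with h1 | h1
  · exact .inl (h1.trans interior_subset)
  · exact .inr (Set.disjoint_left.2 fun x hx hxt => h1 hx (subset_closure hxt))

/-- The graph condition does not say on which side `Ω` lies. A point `x ∈ Ω` near `p` decides: the
sign `σ` of its height `h x` over the graph gives the axis `σ • e`. Neither the vertical segment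
from `x` nor the cone at `p` meets the boundary, both are connected, and the segment ends inside the
cone; hence the cone lies in `Ω`. -/
theorem IsLipschitzSet.hasInteriorCone_of_mem_frontier {N : ℕ}
    {Ω : Set (EuclideanSpace ℝ (Fin N))} (hΩ : IsLipschitzSet Ω)
    {p : EuclideanSpace ℝ (Fin N)} (hp : p ∈ frontier Ω) : HasInteriorCone Ω p := by
  obtain ⟨U, T, K, φ, hU, hpU, hφ, hgraph⟩ := hΩ.boundary_graph p hp
  obtain ⟨R, hR, hRU⟩ := Metric.isOpen_iff.1 hU p hpU
  let e : EuclideanSpace ℝ (Fin N) := T.symm (WithLp.toLp 2 (0, 1))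
  have hTe : T e = WithLp.toLp 2 (0, 1) := T.apply_symm_apply _
  have he : ‖e‖ = 1 := by
    rw [← T.norm_map, hTe]; simp
  let h : EuclideanSpace ℝ (Fin N) → ℝ := fun x => (T x).snd - φ (T x).fst
  have hhp : h p = 0 := sub_eq_zero.2 ((hgraph p hpU).1 hp)
  have hvert : ∀ x t, h (x + t • e) = h x + t := by
    intro x t
    simp only [h, map_add, map_smul, hTe]
    simp; ring
  have hlip : ∀ x y, |h x - h y| ≤ (1 + K) * ‖x - y‖ := by
    intro x y
    have h1 : |(T x).snd - (T y).snd| ≤ ‖x - y‖ := by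
      rw [← T.norm_map, map_sub]
      exact WithLp.norm_snd_le (p := 2) _ (T x - T y)
    have h2 : ‖(T x).fst - (T y).fst‖ ≤ ‖x - y‖ := by
      rw [← T.norm_map, map_sub]
      exact WithLp.norm_fst_le (p := 2) _ (T x - T y)
    have h3 : |φ (T x).fst - φ (T y).fst| ≤ K * ‖(T x).fst - (T y).fst‖ := by
      simpa [dist_eq_norm] using hφ.dist_le_mul (T x).fst (T y).fst
    have h4 : (K : ℝ) * ‖(T x).fst - (T y).fst‖ ≤ K * ‖x - y‖ := by gcongr
    calc |h x - h y| = |((T x).snd - (T y).snd) - (φ (T x).fst - φ (T y).fst)| := by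
          simp only [h]; congr 1; ring
      _ ≤ _ := abs_sub _ _
      _ ≤ _ := by linarith
  have hh0 : ∀ x ∈ Metric.ball p R, h x ≠ 0 → x ∉ frontier Ω := fun x hx hne hxf =>
    hne (sub_eq_zero.2 ((hgraph x (hRU hx)).1 hxf))
  -- With this aperture, leaving the axis at parameter `t` changes `h` by at most `t / 2`, less than
  -- its value `±t` on the axis.
  let ρ : ℝ := (2 * (1 + K))⁻¹
  have hρ : 0 < ρ := by positivity
  have hρ1 : ρ ≤ 1 / 2 := by
    have : (2 : ℝ)⁻¹ = 1 / 2 := by norm_num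
    rw [← this]
    exact inv_anti₀ (by norm_num) (by nlinarith [K.coe_nonneg])
  have hρK : (1 + K) * ρ = 1 / 2 := by simp only [ρ]; field_simp
  let τ : ℝ := R / 4
  have hτ : 0 < τ := by positivity
  -- Distance below `τ * ρ` places `x + τ • (σ • e)` in the cone at `p`.
  obtain ⟨x, hxΩ, hxp⟩ := Metric.mem_closure_iff.1 hp.1 (τ * ρ) (by positivity)
  rw [dist_comm, dist_eq_norm] at hxp
  have hxR : ‖x - p‖ < R / 4 := hxp.trans_le (by
    have := mul_le_mul_of_nonneg_left hρ1 hτ.le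
    simp only [τ] at this ⊢; linarith)
  have hhx : h x ≠ 0 := by
    intro h0
    have : x ∈ frontier Ω := (hgraph x (hRU (by
      rw [Metric.mem_ball, dist_eq_norm]; linarith))).2 (sub_eq_zero.1 h0)
    rw [hΩ.isOpen.frontier_eq] at this
    exact this.2 hxΩ
  obtain ⟨σ, hσ, hσx⟩ : ∃ σ : ℝ, |σ| = 1 ∧ 0 < σ * h x := by
    rcases lt_or_gt_of_ne hhx with h1 | h1
    · exact ⟨-1, by simp, by linarith⟩
    · exact ⟨1, by simp, by linarith⟩
  have hσσ : σ * σ = 1 := by rw [← abs_mul_abs_self, hσ, one_mul]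
  have hne : ‖σ • e‖ = 1 := by rw [norm_smul, he, Real.norm_eq_abs, hσ, one_mul]
  -- the segment from `x` in the direction of the cone
  have hseg : x + τ • (σ • e) ∈ Ω := by
    let γ : ℝ → EuclideanSpace ℝ (Fin N) := fun t => x + t • (σ • e)
    have hpre : IsPreconnected (γ '' Set.Icc 0 τ) :=
      isPreconnected_Icc.image γ (by fun_prop)
    have hd : Disjoint (γ '' Set.Icc 0 τ) (frontier Ω) := by
      rw [Set.disjoint_left]
      rintro _ ⟨t, ht, rfl⟩
      refine hh0 _ ?_ ?_
      · rw [Metric.mem_ball, dist_eq_norm]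
        have h1 : ‖t • (σ • e)‖ ≤ τ := by
          rw [norm_smul, hne, Real.norm_of_nonneg ht.1, mul_one]; exact ht.2
        have h2 : γ t - p = (x - p) + t • (σ • e) := by simp only [γ]; abel
        rw [h2]
        have := norm_add_le (x - p) (t • (σ • e))
        simp only [τ] at h1
        linarith
      · intro h0
        simp only [γ, smul_smul, hvert] at h0
        have : σ * (h x + t * σ) = σ * h x + t := by linear_combination t * hσσ
        rw [h0, mul_zero] at this
        linarith [ht.1]
    rcases hpre.subset_or_disjoint_of_disjoint_frontier hd with hs | hs
    · exact hs ⟨τ, ⟨hτ.le, le_rfl⟩, rfl⟩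
    · exact absurd hxΩ (Set.disjoint_left.1 hs ⟨0, ⟨le_rfl, hτ.le⟩, by simp [γ]⟩)
  -- the cone itself
  let Γ : ℝ × EuclideanSpace ℝ (Fin N) → EuclideanSpace ℝ (Fin N) :=
    fun q => p + q.1 • (σ • e + q.2)
  have hpre : IsPreconnected (Γ '' (Set.Ioc 0 τ ×ˢ Metric.ball 0 ρ)) :=
    (isPreconnected_Ioc.prod (convex_ball (0 : EuclideanSpace ℝ (Fin N)) ρ).isPreconnected).image Γ
      (by fun_prop)
  have hsub : Γ '' (Set.Ioc 0 τ ×ˢ Metric.ball 0 ρ) ⊆ Ω := by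
    have hd : Disjoint (Γ '' (Set.Ioc 0 τ ×ˢ Metric.ball 0 ρ)) (frontier Ω) := by
      rw [Set.disjoint_left]
      rintro _ ⟨⟨t, w⟩, ⟨ht, hw⟩, rfl⟩
      simp only [mem_ball_zero_iff] at hw
      simp only at ht
      have hΓ : Γ (t, w) = (p + (t * σ) • e) + t • w := by
        simp only [Γ, smul_add, smul_smul]; abel
      have htw : ‖t • w‖ ≤ t * ρ := by
        rw [norm_smul, Real.norm_of_nonneg ht.1.le]
        exact mul_le_mul_of_nonneg_left hw.le ht.1.le
      refine hh0 _ ?_ ?_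
      · rw [Metric.mem_ball, dist_eq_norm]
        have h1 : ‖t • (σ • e)‖ ≤ τ := by
          rw [norm_smul, hne, Real.norm_of_nonneg ht.1.le, mul_one]; exact ht.2
        have h2 : Γ (t, w) - p = t • (σ • e) + t • w := by
          simp only [Γ, smul_add]; abel
        rw [h2]
        have := norm_add_le (t • (σ • e)) (t • w)
        have h3 : t * ρ ≤ τ * (1 / 2) := mul_le_mul ht.2 hρ1 hρ.le hτ.le
        simp only [τ] at h1 h3
        linarith
      · intro h0
        have h1 := hlip (Γ (t, w)) (p + (t * σ) • e)
        rw [h0, hvert, hhp, hΓ, add_sub_cancel_left] at h1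
        have h2 : |0 - (0 + t * σ)| = t := by
          rw [zero_add, zero_sub, abs_neg, abs_mul, hσ, abs_of_pos ht.1, mul_one]
        have h3 : (1 + (K : ℝ)) * ‖t • w‖ ≤ t * (1 / 2) := by
          calc (1 + (K : ℝ)) * ‖t • w‖ ≤ (1 + K) * (t * ρ) := by gcongr
            _ = t * (1 / 2) := by rw [← hρK]; ring
        linarith [ht.1]
    rcases hpre.subset_or_disjoint_of_disjoint_frontier hd with hs | hs
    · exact hs
    · refine absurd hseg (Set.disjoint_left.1 hs ⟨(τ, τ⁻¹ • (x - p)), ⟨⟨hτ, le_rfl⟩, ?_⟩, ?_⟩)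
      · rw [mem_ball_zero_iff, norm_smul, Real.norm_of_nonneg (by positivity),
          inv_mul_lt_iff₀ hτ]
        exact hxp
      · simp only [Γ, smul_add, smul_inv_smul₀ hτ.ne']
        abel
  refine ⟨τ • (σ • e), τ * ρ, ?_, by positivity, fun t ht y hy => hsub ?_⟩
  · rw [← norm_pos_iff, norm_smul, hne, Real.norm_of_nonneg hτ.le, mul_one]; exact hτ
  · have htτ : 0 < t * τ := mul_pos ht.1 hτ
    refine ⟨(t * τ, (t * τ)⁻¹ • (y - (p + t • (τ • (σ • e))))), ⟨⟨htτ, ?_⟩, ?_⟩, ?_⟩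
    · simpa using mul_le_mul_of_nonneg_right ht.2 hτ.le
    · rw [mem_ball_zero_iff, norm_smul, Real.norm_of_nonneg (by positivity),
        inv_mul_lt_iff₀ htτ, ← dist_eq_norm, mul_assoc]
      exact hy
    · simp only [Γ, smul_add, smul_inv_smul₀ htτ.ne', mul_smul]
      abel

theorem IsLipschitzSet.hasInteriorCone {N : ℕ} (hN : 1 ≤ N) {Ω : Set (EuclideanSpace ℝ (Fin N))}
    (hΩ : IsLipschitzSet Ω) {x : EuclideanSpace ℝ (Fin N)} (hx : x ∈ closure Ω) :
    HasInteriorCone Ω x := by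
  have : NeZero N := ⟨by omega⟩
  rw [closure_eq_self_union_frontier] at hx
  rcases hx with hx | hx
  · exact .of_mem_isOpen hΩ.isOpen hx
  · exact hΩ.hasInteriorCone_of_mem_frontier hx

/-! ### Finite-dimensional approximation. -/

/-- A bounded set in a normed space is totally bounded if its elements are determined, up to an
arbitrarily small error, by finitely many continuous linear functionals. -/
theorem totallyBounded_of_finite_functionals {L : Type} [NormedAddCommGroup L] [NormedSpace ℝ L]
    {S : Set L} (hS : Bornology.IsBounded S)
    (h : ∀ ε > (0 : ℝ), ∃ (ι : Type) (_ : Fintype ι) (l : ι → L →L[ℝ] ℝ), ∃ δ > (0 : ℝ),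
      ∀ u ∈ S, ∀ v ∈ S, (∀ i, |l i (u - v)| ≤ δ) → ‖u - v‖ < ε) : TotallyBounded S := by
  refine Metric.totallyBounded_of_finite_discretization fun ε hε => ?_
  obtain ⟨ι, _, l, δ, hδ, hl⟩ := h ε hε
  let Φ : L →L[ℝ] (ι → ℝ) := ContinuousLinearMap.pi l
  -- Bounded sets in `ι → ℝ` are totally bounded; a finite net there discretizes `S`.
  have htb : TotallyBounded (Φ '' S) :=
    ((Φ.lipschitz.isBounded_image hS).isCompact_closure.totallyBounded).subset subset_closure
  obtain ⟨t, -, htfin, hcov⟩ := Metric.finite_approx_of_totallyBounded htb (δ / 2) (by positivity)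
  have hex : ∀ u : S, ∃ y : t, Φ u ∈ Metric.ball (y : ι → ℝ) (δ / 2) := by
    intro u
    have := hcov (Set.mem_image_of_mem Φ u.2)
    simp only [Set.mem_iUnion] at this
    obtain ⟨y, hy, hu⟩ := this
    exact ⟨⟨y, hy⟩, hu⟩
  choose F hF using hex
  refine ⟨t, htfin.fintype, F, fun u v huv => ?_⟩
  rw [dist_eq_norm]
  refine hl u u.2 v v.2 fun i => ?_
  have h1 := hF u
  have h2 := hF v
  rw [huv] at h1
  have h3 : dist (Φ u) (Φ v) < δ := by
    have := dist_triangle_right (Φ u) (Φ v) (F v : ι → ℝ)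
    rw [Metric.mem_ball] at h1 h2
    linarith
  have h4 := (dist_le_pi_dist (Φ u) (Φ v) i).trans h3.le
  rw [map_sub, ← Real.dist_eq]
  exact h4

theorem exists_finite_kernel_net {E : Type*} [PseudoMetricSpace E] {k : E × E → ℝ}
    (hk : Continuous k) {K : Set E} (hK : IsCompact K) {ε : ℝ} (hε : 0 < ε) :
    ∃ F : Finset E, ∀ x ∈ K, ∃ x₀ ∈ F, ∀ y ∈ K, |k (x, y) - k (x₀, y)| ≤ ε := by
  have huc := (hK.prod hK).uniformContinuousOn_of_continuous hk.continuousOn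
  obtain ⟨δ, hδ, h⟩ := Metric.uniformContinuousOn_iff.1 huc ε hε
  obtain ⟨t, htK, htfin, hcov⟩ := Metric.finite_approx_of_totallyBounded hK.totallyBounded δ hδ
  refine ⟨htfin.toFinset, fun x hx => ?_⟩
  have := hcov hx
  simp only [Set.mem_iUnion] at this
  obtain ⟨x₀, hx₀, hxx₀⟩ := this
  refine ⟨x₀, htfin.mem_toFinset.2 hx₀, fun y hy => ?_⟩
  have := h (x, y) ⟨hx, hy⟩ (x₀, y) ⟨htK hx₀, hy⟩ (by
    rw [Prod.dist_eq, dist_self]; exact max_lt hxx₀ hδ)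
  rw [← Real.dist_eq]; exact this.le

/-- Integration against a bounded continuous function, as a functional on `L²`. -/
theorem exists_functional_integral_mul {E : Type*} [TopologicalSpace E]
    [MeasurableSpace E] [BorelSpace E] {μ : Measure E} [IsFiniteMeasure μ] {f : E → ℝ} {C : ℝ}
    (hf : Continuous f) (hC : ∀ x, |f x| ≤ C) :
    ∃ l : Lp ℝ 2 μ →L[ℝ] ℝ, ∀ w, l w = ∫ y, f y * w y ∂μ := by
  have hm : MemLp f 2 μ := MemLp.of_bound hf.aestronglyMeasurable C (ae_of_all _ hC)
  refine ⟨innerSL ℝ (hm.toLp f), fun w => ?_⟩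
  rw [innerSL_apply_apply, L2.inner_def]
  refine integral_congr_ae ?_
  filter_upwards [hm.coeFn_toLp] with y hy
  rw [hy]
  simp [mul_comm]

/-! ### Energy estimates for bounded symmetric kernels. -/

section Energy

variable {E : Type*} [NormedAddCommGroup E] [SecondCountableTopology E] [MeasurableSpace E]
  [BorelSpace E] {μ : Measure E} [IsFiniteMeasure μ] {u : E → ℝ} {k : E × E → ℝ} {C : ℝ}

theorem integrable_sq_mul_kernel (hu : MemLp u 2 μ) (hk : Continuous k) (hC : ∀ p, |k p| ≤ C) :
    Integrable (fun p : E × E => u p.1 ^ 2 * k p) (μ.prod μ) :=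
  (hu.integrable_sq.comp_fst μ).mul_bdd hk.aestronglyMeasurable (ae_of_all _ hC)

theorem integrable_mul_mul_kernel (hu : MemLp u 2 μ) (hk : Continuous k) (hC : ∀ p, |k p| ≤ C) :
    Integrable (fun p : E × E => u p.1 * u p.2 * k p) (μ.prod μ) :=
  ((hu.integrable one_le_two).mul_prod (hu.integrable one_le_two)).mul_bdd
    hk.aestronglyMeasurable (ae_of_all _ hC)

theorem integral_sub_sq_mul_kernel (hu : MemLp u 2 μ) (hk : Continuous k) (hC : ∀ p, |k p| ≤ C)
    (hsymm : ∀ p, k p.swap = k p) :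
    Integrable (fun p : E × E => (u p.1 - u p.2) ^ 2 * k p) (μ.prod μ) ∧
    ∫ p, (u p.1 - u p.2) ^ 2 * k p ∂(μ.prod μ)
      = 2 * ∫ x, u x ^ 2 * ∫ y, k (x, y) ∂μ ∂μ - 2 * ∫ p, u p.1 * u p.2 * k p ∂(μ.prod μ) := by
  have h1 := integrable_sq_mul_kernel hu hk hC
  have h2 := integrable_mul_mul_kernel hu hk hC
  have h1' : Integrable (fun p : E × E => u p.2 ^ 2 * k p) (μ.prod μ) := by
    have := h1.swap
    refine this.congr (ae_of_all _ fun p => ?_)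
    simp [hsymm]
  have h3 : ∫ p, u p.2 ^ 2 * k p ∂(μ.prod μ) = ∫ p, u p.1 ^ 2 * k p ∂(μ.prod μ) := by
    rw [← integral_prod_swap]
    exact integral_congr_ae (ae_of_all _ fun p => by simp [hsymm])
  have heq : (fun p : E × E => (u p.1 - u p.2) ^ 2 * k p)
      = fun p => (u p.1 ^ 2 * k p + u p.2 ^ 2 * k p) - 2 * (u p.1 * u p.2 * k p) := by
    funext p; ring
  rw [heq]
  refine ⟨(h1.add h1').sub (h2.const_mul 2), ?_⟩
  rw [integral_sub (f := fun p : E × E => u p.1 ^ 2 * k p + u p.2 ^ 2 * k p) (h1.add h1')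
    (h2.const_mul 2), integral_add h1 h1', h3, integral_const_mul,
    integral_prod _ h1]
  simp only [integral_const_mul]
  ring

theorem mul_integral_sq_le (hu : MemLp u 2 μ) (hk : Continuous k) (hC : ∀ p, |k p| ≤ C)
    (hsymm : ∀ p, k p.swap = k p) {M : ℝ} (hM : ∀ᵐ x ∂μ, M ≤ ∫ y, k (x, y) ∂μ) :
    M * ∫ x, u x ^ 2 ∂μ ≤ 1 / 2 * ∫ p, (u p.1 - u p.2) ^ 2 * k p ∂(μ.prod μ)
      + |∫ p, u p.1 * u p.2 * k p ∂(μ.prod μ)| := by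
  have h1 : M * ∫ x, u x ^ 2 ∂μ ≤ ∫ x, u x ^ 2 * ∫ y, k (x, y) ∂μ ∂μ := by
    rw [← integral_const_mul]
    refine integral_mono_ae (hu.integrable_sq.const_mul M) ?_ ?_
    · have := (integrable_sq_mul_kernel hu hk hC).integral_prod_left
      simpa only [integral_const_mul] using this
    · filter_upwards [hM] with x hx
      rw [mul_comm]
      exact mul_le_mul_of_nonneg_left hx (sq_nonneg _)
  have h2 := (integral_sub_sq_mul_kernel hu hk hC hsymm).2
  have h3 := le_abs_self (∫ p, u p.1 * u p.2 * k p ∂(μ.prod μ))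
  linarith

/-- Replacing `k (x, ·)` by the nearest `k (x₀, ·)` costs `ε` times the `L¹` norm in the inner
integral; the outer integral contributes another `L¹` norm. -/
theorem abs_integral_mul_mul_kernel_le (hu : MemLp u 2 μ) (hk : Continuous k)
    (hC : ∀ p, |k p| ≤ C) {F : Finset E} {ε : ℝ}
    (hF : ∀ᵐ x ∂μ, ∃ x₀ ∈ F, ∀ᵐ y ∂μ, |k (x, y) - k (x₀, y)| ≤ ε) :
    |∫ p, u p.1 * u p.2 * k p ∂(μ.prod μ)|
      ≤ (∑ x₀ ∈ F, |∫ y, k (x₀, y) * u y ∂μ| + ε * ∫ x, |u x| ∂μ) * ∫ x, |u x| ∂μ := by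
  have hu1 : Integrable u μ := hu.integrable one_le_two
  have hku : ∀ x, Integrable (fun y => k (x, y) * u y) μ := fun x =>
    hu1.bdd_mul (hk.comp (Continuous.prodMk_right x)).aestronglyMeasurable
      (ae_of_all _ fun y => hC (x, y))
  rw [integral_prod _ (integrable_mul_mul_kernel hu hk hC), ← Real.norm_eq_abs,
    ← integral_const_mul]
  refine norm_integral_le_of_norm_le (hu1.abs.const_mul _) ?_
  filter_upwards [hF] with x ⟨x₀, hx₀, hx⟩
  have h1 : ∫ y, u x * u y * k (x, y) ∂μ = u x * ∫ y, k (x, y) * u y ∂μ := by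
    rw [← integral_const_mul]
    exact integral_congr_ae (ae_of_all _ fun y => by ring)
  rw [h1, norm_mul, mul_comm, Real.norm_eq_abs, Real.norm_eq_abs]
  refine mul_le_mul_of_nonneg_right ?_ (abs_nonneg _)
  have h2 : |∫ y, k (x, y) * u y ∂μ - ∫ y, k (x₀, y) * u y ∂μ| ≤ ε * ∫ x, |u x| ∂μ := by
    rw [← integral_sub (hku x) (hku x₀), ← Real.norm_eq_abs, ← integral_const_mul]
    refine norm_integral_le_of_norm_le (hu1.abs.const_mul _) ?_
    filter_upwards [hx] with y hy
    rw [← sub_mul, norm_mul]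
    exact mul_le_mul_of_nonneg_right hy (abs_nonneg _)
  have h3 : |∫ y, k (x₀, y) * u y ∂μ| ≤ ∑ x₀ ∈ F, |∫ y, k (x₀, y) * u y ∂μ| :=
    Finset.single_le_sum (f := fun x₀ => |∫ y, k (x₀, y) * u y ∂μ|)
      (fun _ _ => abs_nonneg _) hx₀
  have h4 := abs_sub_abs_le_abs_sub (∫ y, k (x, y) * u y ∂μ) (∫ y, k (x₀, y) * u y ∂μ)
  linarith

end Energy

/-- `hr` covers the diagonal, where `t ^ a` may be `0` and the quotient is `0` by convention. -/
theorem regKernel_mul_sq_le {a η t r : ℝ} (hη : 0 < η) (ht : 0 ≤ t) (hr : t = 0 → r = 0) :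
    r ^ 2 * regKernel a η t ≤ r ^ 2 / t ^ a := by
  rcases ht.eq_or_lt with h | h
  · simp [hr h.symm]
  · rw [div_eq_mul_inv]
    refine mul_le_mul_of_nonneg_left (inv_anti₀ (by positivity) (by linarith)) (sq_nonneg _)

theorem ofReal_integral_regKernel_le {N : ℕ} (Ω : Set (EuclideanSpace ℝ (Fin N))) (s : ℝ)
    {u : EuclideanSpace ℝ (Fin N) → ℝ} {η : ℝ} (hη : 0 < η)
    (hint : Integrable (fun p : EuclideanSpace ℝ (Fin N) × EuclideanSpace ℝ (Fin N) =>
      (u p.1 - u p.2) ^ 2 * regKernel (N + 2 * s) η ‖p.1 - p.2‖)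
      ((volume.restrict Ω).prod (volume.restrict Ω))) :
    ENNReal.ofReal (∫ p, (u p.1 - u p.2) ^ 2 * regKernel (N + 2 * s) η ‖p.1 - p.2‖
      ∂((volume.restrict Ω).prod (volume.restrict Ω))) ≤ seminormIntegral Ω s u := by
  rw [ofReal_integral_eq_lintegral_ofReal hint (ae_of_all _ fun p =>
    mul_nonneg (sq_nonneg _) (regKernel_nonneg hη (norm_nonneg _)))]
  refine lintegral_mono fun p => ENNReal.ofReal_le_ofReal ?_
  refine regKernel_mul_sq_le hη (norm_nonneg _) fun h => ?_
  rw [sub_eq_zero.1 (norm_eq_zero.1 h), sub_self]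

/-- On a Lipschitz set, finitely many functionals control the `L²` norm of functions of bounded
energy, up to an arbitrarily small error. -/
theorem IsLipschitzSet.exists_functionals_control {N : ℕ} (hN : 1 ≤ N)
    {Ω : Set (EuclideanSpace ℝ (Fin N))} (hΩ : IsLipschitzSet Ω) {s : ℝ} (hs : 0 ≤ s)
    {ε : ℝ} (hε : 0 < ε) :
    ∃ (ι : Type) (_ : Fintype ι) (l : ι → L2Space Ω →L[ℝ] ℝ), ∃ δ > (0 : ℝ),
      ∀ w : L2Space Ω, ‖w‖ ≤ 2 → seminormIntegral Ω s w ≤ ENNReal.ofReal 8 →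
        (∀ i, |l i w| ≤ δ) → ‖w‖ < ε := by
  have hfin : volume Ω < ⊤ := hΩ.isBounded.measure_lt_top
  have : IsFiniteMeasure (volume.restrict Ω) := ⟨by simpa using hfin⟩
  set μ : Measure (EuclideanSpace ℝ (Fin N)) := volume.restrict Ω with hμ
  have hK : IsCompact (closure Ω) := hΩ.isBounded.isCompact_closure
  have ha0 : 0 ≤ (N : ℝ) + 2 * s := by positivity
  -- Half the energy contributes at most 4 and the cross term at most 1, so 6 leaves a strict
  -- margin.
  obtain ⟨η, hη, hpot⟩ := exists_forall_lt_integral_regKernel hfin hK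
    (fun x hx => hΩ.hasInteriorCone hN hx) ha0 (by linarith : (N : ℝ) ≤ N + 2 * s) (6 / ε ^ 2)
  let k : EuclideanSpace ℝ (Fin N) × EuclideanSpace ℝ (Fin N) → ℝ :=
    fun p => regKernel (N + 2 * s) η ‖p.1 - p.2‖
  have hk : Continuous k := continuous_regKernel_norm ha0 hη
  have hC : ∀ p, |k p| ≤ η⁻¹ := fun p => by
    rw [abs_of_nonneg (regKernel_nonneg hη (norm_nonneg _))]
    exact regKernel_le hη (norm_nonneg _)
  have hsymm : ∀ p, k p.swap = k p := fun p => by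
    simp only [k, Prod.fst_swap, Prod.snd_swap, norm_sub_rev]
  have hmem : ∀ᵐ x ∂μ, x ∈ closure Ω := by
    filter_upwards [ae_restrict_mem hΩ.isOpen.measurableSet] with x hx using subset_closure hx
  -- A bound for the `L¹` norm, from `|w| ≤ 1 + w²` and `‖w‖² ≤ 4`.
  let A : ℝ := μ.real Set.univ + 4
  have hA : 0 < A := by positivity
  obtain ⟨F, hF⟩ := exists_finite_kernel_net hk hK (ε := 1 / (2 * A * A)) (by positivity)
  choose l hl using fun x₀ : EuclideanSpace ℝ (Fin N) =>
    exists_functional_integral_mul (μ := μ) (f := fun y => k (x₀, y))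
      (hk.comp (Continuous.prodMk_right x₀)) fun y => hC (x₀, y)
  -- The net error and the functionals each contribute at most `1/2` to the cross term; `F.card + 1`
  -- allows an empty `F`.
  refine ⟨F, inferInstance, fun x₀ => l x₀, 1 / (2 * (F.card + 1) * A), by positivity,
    fun w hw hE hlw => ?_⟩
  have hmw : MemLp w 2 μ := Lp.memLp w
  have hsq : ∫ x, w x ^ 2 ∂μ = ‖w‖ ^ 2 := by
    rw [← real_inner_self_eq_norm_sq, L2.inner_def]
    exact integral_congr_ae (ae_of_all _ fun x => by simp [sq])
  have hL1 : ∫ x, |w x| ∂μ ≤ A := by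
    calc ∫ x, |w x| ∂μ ≤ ∫ x, (1 + w x ^ 2) ∂μ := by
          refine integral_mono (hmw.integrable one_le_two).abs
            ((integrable_const 1).add hmw.integrable_sq) fun x => ?_
          change |w x| ≤ 1 + w x ^ 2
          nlinarith [sq_nonneg (|w x| - 1), sq_abs (w x), abs_nonneg (w x)]
      _ = μ.real Set.univ + ‖w‖ ^ 2 := by
          rw [integral_add (integrable_const 1) hmw.integrable_sq, hsq]; simp
      _ ≤ A := by
          have : ‖w‖ ^ 2 ≤ 4 := by nlinarith [norm_nonneg w]
          simp only [A]; linarith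
  have hL0 : 0 ≤ ∫ x, |w x| ∂μ := integral_nonneg fun x => abs_nonneg _
  have h1 := mul_integral_sq_le hmw hk hC hsymm (M := 6 / ε ^ 2)
    (hmem.mono fun x hx => (hpot x hx).le)
  have h2 := abs_integral_mul_mul_kernel_le hmw hk hC (F := F) (ε := 1 / (2 * A * A)) <| by
    filter_upwards [hmem] with x hx
    obtain ⟨x₀, hx₀, h⟩ := hF x hx
    exact ⟨x₀, hx₀, hmem.mono h⟩
  have h3 : ∫ p, (w p.1 - w p.2) ^ 2 * k p ∂(μ.prod μ) ≤ 8 := by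
    have := (ofReal_integral_regKernel_le Ω s hη
      (integral_sub_sq_mul_kernel hmw hk hC hsymm).1).trans hE
    exact (ENNReal.ofReal_le_ofReal_iff (by norm_num)).1 this
  have h4 : ∑ x₀ ∈ F, |∫ y, k (x₀, y) * w y ∂μ| ≤ 1 / (2 * A) := by
    calc ∑ x₀ ∈ F, |∫ y, k (x₀, y) * w y ∂μ|
        ≤ ∑ x₀ ∈ F, 1 / (2 * (F.card + 1) * A) :=
          Finset.sum_le_sum fun x₀ hx₀ => by rw [← hl]; exact hlw ⟨x₀, hx₀⟩
      _ = F.card / (F.card + 1) * (1 / (2 * A)) := by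
          rw [Finset.sum_const, nsmul_eq_mul]; field_simp
      _ ≤ 1 * (1 / (2 * A)) := by
          refine mul_le_mul_of_nonneg_right ?_ (by positivity)
          rw [div_le_one (by positivity)]; linarith
      _ = _ := one_mul _
  have h5 : (∑ x₀ ∈ F, |∫ y, k (x₀, y) * w y ∂μ| + 1 / (2 * A * A) * ∫ x, |w x| ∂μ)
      * ∫ x, |w x| ∂μ ≤ 1 := by
    calc _ ≤ (1 / (2 * A) + 1 / (2 * A * A) * A) * A := by gcongr
      _ = 1 := by field_simp; norm_num
  rw [hsq] at h1
  have h6 : 6 / ε ^ 2 * ‖w‖ ^ 2 < 6 := by linarith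
  rw [div_mul_eq_mul_div, div_lt_iff₀ (by positivity)] at h6
  exact lt_of_pow_lt_pow_left₀ 2 hε.le (by linarith)

/-! ### The Hilbert space structure through difference quotients. -/

/-- The difference quotient `(u(x) - u(y)) / |x - y|^(N/2 + s)`. -/
noncomputable def diffQuotient {N : ℕ} (s : ℝ) (u : EuclideanSpace ℝ (Fin N) → ℝ)
    (p : EuclideanSpace ℝ (Fin N) × EuclideanSpace ℝ (Fin N)) : ℝ :=
  (u p.1 - u p.2) / ‖p.1 - p.2‖ ^ (((N : ℝ) + 2 * s) / 2)

/-- Splitting the kernel evenly between the two factors reduces absolute convergence to Hölder's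
inequality. -/
theorem diffQuotient_mul {N : ℕ} (s : ℝ) (u v : EuclideanSpace ℝ (Fin N) → ℝ)
    (p : EuclideanSpace ℝ (Fin N) × EuclideanSpace ℝ (Fin N)) :
    diffQuotient s u p * diffQuotient s v p = formIntegrand s u v p := by
  have h : ‖p.1 - p.2‖ ^ (((N : ℝ) + 2 * s) / 2) * ‖p.1 - p.2‖ ^ (((N : ℝ) + 2 * s) / 2)
      = ‖p.1 - p.2‖ ^ ((N : ℝ) + 2 * s) := by
    rw [← sq, ← Real.rpow_natCast, ← Real.rpow_mul (norm_nonneg _)]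
    congr 1
    push_cast
    ring
  rw [diffQuotient, diffQuotient, formIntegrand, div_mul_div_comm, h]

theorem measurable_diffQuotient {N : ℕ} (s : ℝ) {u : EuclideanSpace ℝ (Fin N) → ℝ}
    (hu : Measurable u) : Measurable (diffQuotient s u) := by
  unfold diffQuotient
  fun_prop

theorem ofReal_diffQuotient_sq {N : ℕ} (s : ℝ) (u : EuclideanSpace ℝ (Fin N) → ℝ)
    (p : EuclideanSpace ℝ (Fin N) × EuclideanSpace ℝ (Fin N)) :
    ENNReal.ofReal (diffQuotient s u p ^ 2)
      = ENNReal.ofReal ((u p.1 - u p.2) ^ 2 / ‖p.1 - p.2‖ ^ ((N : ℝ) + 2 * s)) := by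
  rw [sq, diffQuotient_mul, formIntegrand, sq]

theorem memLp_diffQuotient_iff {N : ℕ} {Ω : Set (EuclideanSpace ℝ (Fin N))} {s : ℝ}
    {u : EuclideanSpace ℝ (Fin N) → ℝ} (hu : Measurable u) :
    MemLp (diffQuotient s u) 2 ((volume.restrict Ω).prod (volume.restrict Ω))
      ↔ seminormIntegral Ω s u < ⊤ := by
  have hm := measurable_diffQuotient s hu
  rw [memLp_two_iff_integrable_sq hm.aestronglyMeasurable, Integrable,
    and_iff_right (hm.pow_const 2).aestronglyMeasurable,
    hasFiniteIntegral_iff_ofReal (ae_of_all _ fun p => sq_nonneg _)]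
  simp only [ofReal_diffQuotient_sq, seminormIntegral]

theorem diffQuotient_congr {N : ℕ} {Ω : Set (EuclideanSpace ℝ (Fin N))} {s : ℝ}
    {u v : EuclideanSpace ℝ (Fin N) → ℝ} (h : u =ᵐ[volume.restrict Ω] v) :
    diffQuotient s u =ᵐ[(volume.restrict Ω).prod (volume.restrict Ω)] diffQuotient s v := by
  filter_upwards [Measure.quasiMeasurePreserving_fst.ae_eq_comp h,
    Measure.quasiMeasurePreserving_snd.ae_eq_comp h] with p h1 h2
  simp only [Function.comp] at h1 h2
  simp only [diffQuotient, h1, h2]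

namespace HsSpace

variable {N : ℕ} {Ω : Set (EuclideanSpace ℝ (Fin N))} {s : ℝ}

theorem memLp_diffQuotient (u : HsSpace Ω s) :
    MemLp (diffQuotient s (toL2 u)) 2 ((volume.restrict Ω).prod (volume.restrict Ω)) :=
  (memLp_diffQuotient_iff (Lp.stronglyMeasurable _).measurable).2 u.2

/-- The difference quotient as a linear map `ℍ^s(Ω) → L²(Ω × Ω)`. -/
noncomputable def quotientL2 :
    HsSpace Ω s →ₗ[ℝ] Lp ℝ 2 ((volume.restrict Ω).prod (volume.restrict Ω)) where
  toFun u := (memLp_diffQuotient u).toLp _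
  map_add' u v := by
    rw [← MemLp.toLp_add]
    refine MemLp.toLp_congr _ _ ?_
    rw [map_add]
    refine (diffQuotient_congr (Lp.coeFn_add (toL2 u) (toL2 v))).trans (ae_of_all _ fun p => ?_)
    simp only [diffQuotient, Pi.add_apply]
    ring
  map_smul' c u := by
    rw [RingHom.id_apply, ← MemLp.toLp_const_smul]
    refine MemLp.toLp_congr _ _ ?_
    rw [map_smul]
    refine (diffQuotient_congr (Lp.coeFn_smul c (toL2 u))).trans (ae_of_all _ fun p => ?_)
    simp only [diffQuotient, Pi.smul_apply, smul_eq_mul]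
    ring

theorem coeFn_quotientL2 (u : HsSpace Ω s) :
    quotientL2 u =ᵐ[(volume.restrict Ω).prod (volume.restrict Ω)] diffQuotient s (toL2 u) :=
  (memLp_diffQuotient u).coeFn_toLp

theorem integrable_formIntegrand (u v : HsSpace Ω s) :
    Integrable (formIntegrand s (toL2 u) (toL2 v))
      ((volume.restrict Ω).prod (volume.restrict Ω)) := by
  refine ((memLp_diffQuotient u).integrable_mul (memLp_diffQuotient v)).congr
    (ae_of_all _ fun p => ?_)
  exact diffQuotient_mul s _ _ p

theorem inner_quotientL2 (u v : HsSpace Ω s) :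
    inner ℝ (quotientL2 u) (quotientL2 v) = ∫ p, formIntegrand s (toL2 u) (toL2 v) p
      ∂((volume.restrict Ω).prod (volume.restrict Ω)) := by
  rw [L2.inner_def]
  refine integral_congr_ae ?_
  filter_upwards [coeFn_quotientL2 u, coeFn_quotientL2 v] with p h1 h2
  rw [h1, h2, ← diffQuotient_mul, real_inner_eq_re_inner, RCLike.inner_apply]
  simp [mul_comm]

theorem seminormIntegral_toL2 (u : HsSpace Ω s) :
    seminormIntegral Ω s (toL2 u) = ENNReal.ofReal (‖quotientL2 u‖ ^ 2) := by
  rw [← real_inner_self_eq_norm_sq, inner_quotientL2,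
    ofReal_integral_eq_lintegral_ofReal (integrable_formIntegrand u u)]
  · refine lintegral_congr fun p => ?_
    rw [formIntegrand, sq]
  · refine ae_of_all _ fun p => ?_
    rw [← diffQuotient_mul]
    exact mul_self_nonneg _

theorem toL2_injective : Function.Injective (toL2 : HsSpace Ω s → L2Space Ω) :=
  Subtype.val_injective

/-- The inner product `⟨u, v⟩₂ + ℰ_s(u, v)` on `ℍ^s(Ω)`. -/
@[reducible]
noncomputable def innerCore : InnerProductSpace.Core ℝ (HsSpace Ω s) where
  inner u v := inner ℝ (toL2 u) (toL2 v) + (1 / 2) * inner ℝ (quotientL2 u) (quotientL2 v)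
  conj_inner_symm u v := by
    simp only [real_inner_comm, conj_trivial]
  re_inner_nonneg u := by
    simp only [RCLike.re_to_real, real_inner_self_eq_norm_sq]
    positivity
  add_left u v w := by
    simp only [map_add, inner_add_left]
    ring
  smul_left u v c := by
    simp only [map_smul, real_inner_smul_left, conj_trivial]
    ring
  definite u h := by
    simp only [real_inner_self_eq_norm_sq] at h
    have h1 : ‖toL2 u‖ = 0 := by nlinarith [sq_nonneg ‖toL2 u‖, sq_nonneg ‖quotientL2 u‖]
    exact toL2_injective ((norm_eq_zero.1 h1).trans (map_zero _).symm)

theorem norm_innerCore_sq (u : HsSpace Ω s) :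
    letI : NormedAddCommGroup (HsSpace Ω s) := innerCore.toNormedAddCommGroup
    ‖u‖ ^ 2 = ‖toL2 u‖ ^ 2 + (1 / 2) * ‖quotientL2 u‖ ^ 2 := by
  let _ : NormedAddCommGroup (HsSpace Ω s) := innerCore.toNormedAddCommGroup
  let _ : InnerProductSpace ℝ (HsSpace Ω s) := InnerProductSpace.ofCore innerCore.toCore
  rw [← real_inner_self_eq_norm_sq u, ← real_inner_self_eq_norm_sq (toL2 u),
    ← real_inner_self_eq_norm_sq (quotientL2 u)]
  rfl

/-- The graph of `u ↦ quotientL2 u` is closed in `L²(Ω) × L²(Ω × Ω)`. -/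
theorem exists_of_tendsto {u : ℕ → HsSpace Ω s} {f : L2Space Ω}
    {g : Lp ℝ 2 ((volume.restrict Ω).prod (volume.restrict Ω))}
    (hf : Filter.Tendsto (fun n => toL2 (u n)) Filter.atTop (nhds f))
    (hg : Filter.Tendsto (fun n => quotientL2 (u n)) Filter.atTop (nhds g)) :
    ∃ v : HsSpace Ω s, toL2 v = f ∧ quotientL2 v = g := by
  -- Along a common subsequence both limits hold almost everywhere; convergence on `Ω` lifts to both
  -- coordinates of `Ω × Ω`, so the quotient of `f` must be `g`.
  obtain ⟨ns, hns, hfae⟩ := (tendstoInMeasure_of_tendsto_Lp hf).exists_seq_tendsto_ae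
  obtain ⟨ms, hms, hgae⟩ := (tendstoInMeasure_of_tendsto_Lp
    (hg.comp hns.tendsto_atTop)).exists_seq_tendsto_ae
  have hae : diffQuotient s f =ᵐ[(volume.restrict Ω).prod (volume.restrict Ω)] g := by
    filter_upwards [hgae, Measure.quasiMeasurePreserving_fst.ae hfae,
      Measure.quasiMeasurePreserving_snd.ae hfae,
      ae_all_iff.2 fun n => coeFn_quotientL2 (u n)] with p h1 h2 h3 h4
    refine tendsto_nhds_unique (f := fun i => diffQuotient s (toL2 (u (ns (ms i)))) p) ?_ ?_
      (l := Filter.atTop)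
    · exact ((h2.comp hms.tendsto_atTop).sub (h3.comp hms.tendsto_atTop)).div_const _
    · refine h1.congr fun i => ?_
      exact h4 _
  have hmem : MemLp (diffQuotient s f) 2 ((volume.restrict Ω).prod (volume.restrict Ω)) :=
    (Lp.memLp g).ae_eq hae.symm
  let v : HsSpace Ω s :=
    ⟨f, (memLp_diffQuotient_iff (Lp.stronglyMeasurable f).measurable).1 hmem⟩
  exact ⟨v, rfl, Lp.ext ((coeFn_quotientL2 v).trans hae)⟩

end HsSpace

/-! ### Completeness and compact embedding. -/

/-- A normed group is complete if its norm is a graph norm of two maps with closed joint graph. -/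
theorem completeSpace_of_graph_norm {H L W : Type*} [NormedAddCommGroup H] [NormedAddCommGroup L]
    [NormedAddCommGroup W] [CompleteSpace L] [CompleteSpace W] {A : H → L} {G : H → W}
    (hA : ∀ x y, A (x - y) = A x - A y) (hG : ∀ x y, G (x - y) = G x - G y)
    (hnorm : ∀ x, ‖x‖ ^ 2 = ‖A x‖ ^ 2 + (1 / 2) * ‖G x‖ ^ 2)
    (hclosed : ∀ (u : ℕ → H) (f : L) (g : W),
      Filter.Tendsto (fun n => A (u n)) Filter.atTop (nhds f) →
      Filter.Tendsto (fun n => G (u n)) Filter.atTop (nhds g) → ∃ v, A v = f ∧ G v = g) :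
    CompleteSpace H := by
  refine Metric.complete_of_cauchySeq_tendsto fun u hu => ?_
  have hAle : ∀ x, ‖A x‖ ≤ 2 * ‖x‖ := fun x => by
    refine le_of_sq_le_sq ?_ (by positivity)
    nlinarith [hnorm x, sq_nonneg ‖G x‖, sq_nonneg ‖x‖]
  -- The weight `1/2` gives the constant `√2`; 2 is a convenient upper bound.
  have hGle : ∀ x, ‖G x‖ ≤ 2 * ‖x‖ := fun x => by
    refine le_of_sq_le_sq ?_ (by positivity)
    nlinarith [hnorm x, sq_nonneg ‖A x‖, sq_nonneg ‖x‖]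
  have hAlip : LipschitzWith 2 A := LipschitzWith.of_dist_le_mul fun x y => by
    rw [dist_eq_norm, dist_eq_norm, ← hA]; exact hAle _
  have hGlip : LipschitzWith 2 G := LipschitzWith.of_dist_le_mul fun x y => by
    rw [dist_eq_norm, dist_eq_norm, ← hG]; exact hGle _
  obtain ⟨f, hf⟩ := cauchySeq_tendsto_of_complete (hAlip.uniformContinuous.comp_cauchySeq hu)
  obtain ⟨g, hg⟩ := cauchySeq_tendsto_of_complete (hGlip.uniformContinuous.comp_cauchySeq hu)
  obtain ⟨v, rfl, rfl⟩ := hclosed u f g hf hg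
  refine ⟨v, tendsto_iff_norm_sub_tendsto_zero.2 ?_⟩
  have h1 := (tendsto_iff_norm_sub_tendsto_zero.1 hf).pow 2
  have h2 := ((tendsto_iff_norm_sub_tendsto_zero.1 hg).pow 2).const_mul (1 / 2)
  have h3 := (h1.add h2).sqrt
  simp only [Function.comp_apply, ← hA, ← hG, ← hnorm] at h3
  simpa [Real.sqrt_sq] using h3

/-- A map on a normed group is compact if it maps the closed unit ball to a totally bounded set. -/
theorem isCompactOperator_of_totallyBounded {H L : Type*} [NormedAddCommGroup H]
    [NormedAddCommGroup L] [CompleteSpace L] {A : H → L}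
    (h : TotallyBounded (A '' {x | ‖x‖ ≤ 1})) : IsCompactOperator A := by
  refine ⟨closure (A '' {x | ‖x‖ ≤ 1}), h.closure.isCompact_of_isClosed isClosed_closure, ?_⟩
  filter_upwards [Metric.closedBall_mem_nhds (0 : H) one_pos] with x hx
  exact subset_closure ⟨x, by simpa using hx, rfl⟩

/-- Differences within the unit ball have norm at most 2, hence `L²` norm at most 2 and double
integral at most `2 * 2² = 8`: the thresholds in `exists_functionals_control`. -/
theorem IsLipschitzSet.isCompactOperator_toL2 {N : ℕ} (hN : 1 ≤ N)
    {Ω : Set (EuclideanSpace ℝ (Fin N))} (hΩ : IsLipschitzSet Ω) {s : ℝ} (hs : 0 ≤ s) :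
    letI : NormedAddCommGroup (HsSpace Ω s) := HsSpace.innerCore.toNormedAddCommGroup
    IsCompactOperator (HsSpace.toL2 : HsSpace Ω s → L2Space Ω) := by
  let _ : NormedAddCommGroup (HsSpace Ω s) := HsSpace.innerCore.toNormedAddCommGroup
  have hle : ∀ (u : HsSpace Ω s) (r : ℝ), 0 ≤ r → ‖u‖ ≤ r → ‖HsSpace.toL2 u‖ ≤ r ∧
      ‖HsSpace.quotientL2 u‖ ^ 2 ≤ 2 * r ^ 2 := by
    intro u r hr hu
    have h1 : ‖u‖ ^ 2 = _ := HsSpace.norm_innerCore_sq u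
    have h2 : ‖u‖ ^ 2 ≤ r ^ 2 := pow_le_pow_left₀ (norm_nonneg _) hu 2
    refine ⟨le_of_sq_le_sq ?_ hr, ?_⟩ <;>
    nlinarith [sq_nonneg ‖HsSpace.toL2 u‖, sq_nonneg ‖HsSpace.quotientL2 u‖]
  refine isCompactOperator_of_totallyBounded (totallyBounded_of_finite_functionals ?_ ?_)
  · refine isBounded_iff_forall_norm_le.2 ⟨1, ?_⟩
    rintro _ ⟨u, hu, rfl⟩
    exact (hle u 1 zero_le_one hu).1
  · intro ε hε
    obtain ⟨ι, _, l, δ, hδ, h⟩ := hΩ.exists_functionals_control hN hs hε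
    refine ⟨ι, inferInstance, l, δ, hδ, ?_⟩
    rintro _ ⟨u, hu, rfl⟩ _ ⟨v, hv, rfl⟩ hl
    have huv : ‖u - v‖ ≤ 2 := by
      have := norm_sub_le u v
      have h1 : ‖u‖ ≤ 1 := hu
      have h2 : ‖v‖ ≤ 1 := hv
      linarith
    obtain ⟨h1, h2⟩ := hle (u - v) 2 zero_le_two huv
    have hsub : HsSpace.toL2 (u - v) = HsSpace.toL2 u - HsSpace.toL2 v := map_sub _ _ _
    rw [← hsub] at hl ⊢
    refine h _ h1 ?_ hl
    rw [HsSpace.seminormIntegral_toL2]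
    exact ENNReal.ofReal_le_ofReal (by linarith)

theorem mainTheorem10 (N : ℕ) (hN : 1 ≤ N) (Ω : Set (EuclideanSpace ℝ (Fin N)))
    (hΩ : IsLipschitzSet Ω) (s : ℝ) (hs : s ∈ Set.Ico (0 : ℝ) 1) :
    (∀ u v : HsSpace Ω s,
      Integrable (formIntegrand s (HsSpace.toL2 u) (HsSpace.toL2 v))
        ((volume.restrict Ω).prod (volume.restrict Ω))) ∧
    ∃ core : InnerProductSpace.Core ℝ (HsSpace Ω s),
      (∀ u v : HsSpace Ω s, core.inner u v =
        inner ℝ (HsSpace.toL2 u) (HsSpace.toL2 v)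
          + formE Ω s (HsSpace.toL2 u) (HsSpace.toL2 v)) ∧
      (letI : NormedAddCommGroup (HsSpace Ω s) := core.toNormedAddCommGroup
       CompleteSpace (HsSpace Ω s) ∧
        IsCompactOperator (HsSpace.toL2 : HsSpace Ω s → L2Space Ω)) := by
  refine ⟨HsSpace.integrable_formIntegrand, HsSpace.innerCore, fun u v => ?_, ?_,
    hΩ.isCompactOperator_toL2 hN hs.1⟩
  · rw [formE, ← HsSpace.inner_quotientL2]
    rfl
  · let _ : NormedAddCommGroup (HsSpace Ω s) := HsSpace.innerCore.toNormedAddCommGroup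
    exact completeSpace_of_graph_norm (A := HsSpace.toL2) (G := HsSpace.quotientL2)
      (fun x y => map_sub _ x y) (fun x y => map_sub _ x y) HsSpace.norm_innerCore_sq
      fun _ _ _ => HsSpace.exists_of_tendsto
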